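/- Throughout, $p$ denotes a prime and $\nu$ an integer $\geq 1$. For real $x\ge 1$, $A>0$, $B>0$, let $\mathcal M(x;A,B)$ be the class of multiplicative functions $f:\mathbb N^*\to\mathbb C$ (with $f(1)=1$) such that $$\max_{p\le x}|f(p)|\le A,\qquad \sum_{\substack{p^\nu\le x\\ \nu\ge 2}}\frac{|f(p^\nu)|\log p^\nu}{p^\nu}\le B,$$ the first condition being void if $x<2$. Theorem. For all $A>0$, $B>0$ there is a constant $C=C(A,B)$ with the following property. Let $x\ge 1$, let $\lambda\in\mathcal M(x;A,B)$ take only real non-negative values, and let $\vartheta:\mathbb N^*\to\mathbb C$ be additive, i.e. $\vartheta(mn)=\vartheta(m)+\vartheta(n)$ for all coprime $m,n\ge 1$. Put $$\Theta(x):=\sum_{p^\nu\le x}\frac{\lambda(p^\nu)\vartheta(p^\nu)}{p^\nu},\qquad \mathfrak S(x):=\sum_{p^\nu\le x}\frac{\lambda(p^\nu)|\vartheta(p^\nu)|^2}{p^\nu}.$$ Then $$\sum_{n\le x}\frac{\lambda(n)}{n}\,|\vartheta(n)-\Theta(x)|^2\le C\,\Big(\sum_{n\le x}\frac{\lambda(n)}{n}\Big)\,\mathfrak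 S(x).$$ -/

import Mathlib

/-- The prime powers `p ^ ν ≤ x` with `p` prime and `ν ≥ 1`. -/
noncomputable def primePowersUpTo (x : ℝ) : Finset ℕ :=
  (Finset.Icc 1 ⌊x⌋₊).filter (fun q => IsPrimePow q)

/-- The prime powers `p ^ ν ≤ x` with `p` prime and `ν ≥ 2`. -/
noncomputable def properPrimePowersUpTo (x : ℝ) : Finset ℕ :=
  (primePowersUpTo x).filter (fun q => ¬ q.Prime)

/-- The class `M(x; A, B)` of multiplicative functions `f` (with `f 1 = 1`) such that
`|f p| ≤ A` for all primes `p ≤ x`, and the sum of `|f (p ^ ν)| * log (p ^ ν) / p ^ ν` over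
the prime powers `p ^ ν ≤ x` with `ν ≥ 2` is at most `B`. -/
structure MemMultClass {𝕜 : Type*} [RCLike 𝕜] (x A B : ℝ) (f : ArithmeticFunction 𝕜) :
    Prop where
  isMultiplicative : f.IsMultiplicative
  norm_prime_le : ∀ p : ℕ, p.Prime → (p : ℝ) ≤ x → ‖f p‖ ≤ A
  sum_le : ∑ q ∈ properPrimePowersUpTo x, ‖f q‖ * Real.log (q : ℝ) / (q : ℝ) ≤ B

/-- Additive arithmetic functions. The value at `0` is irrelevant. -/
def IsAdditiveArith (θ : ℕ → ℂ) : Prop :=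
  ∀ m n : ℕ, 0 < m → 0 < n → m.Coprime n → θ (m * n) = θ m + θ n

/-- The weighted sum of `l (p ^ ν) * θ (p ^ ν) / p ^ ν` over the prime powers `p ^ ν ≤ x`. -/
noncomputable def firstMoment (l : ArithmeticFunction ℝ) (θ : ℕ → ℂ) (x : ℝ) : ℂ :=
  ∑ q ∈ primePowersUpTo x, (l q : ℂ) * θ q / (q : ℂ)

/-- The weighted sum of `l (p ^ ν) * |θ (p ^ ν)| ^ 2 / p ^ ν` over the prime powers
`p ^ ν ≤ x`. -/
noncomputable def secondMoment (l : ArithmeticFunction ℝ) (θ : ℕ → ℂ) (x : ℝ) : ℝ :=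
  ∑ q ∈ primePowersUpTo x, l q * ‖θ q‖ ^ 2 / (q : ℝ)

/-!
Put `w n = l n / n`, `N = ⌊x⌋₊` and `D = lcm (1, ..., N)`. Every `n ≤ N` divides `D`, and a prime
power divides `D` exactly when it is at most `N`, so it suffices to bound the second moment of
`θ - Θ` over all divisors of `D`. There the components at different primes are independent, and the
variance is computed prime by prime; replacing the true mean by `Θ` costs a bias that only sees
`∑ w p ^ 2` and the higher prime powers, and is therefore bounded.

The divisors `d > N` carry at most a constant multiple of the mass of `n ≤ N`. Split `D` into its
`N ^ c`-smooth and `N ^ c`-rough parts. For small `c` the mean of `log d` over the divisors of the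
smooth part is at most `log N / 2`, so Markov's inequality puts half of their mass on `d ≤ N`; the
rough part multiplies the mass by a bounded factor, because `w` has bounded sum over the prime
powers `q ≤ N` of primes `p > N ^ c`, as `∑ w q log q ≪ log N`.
-/

section DivisorSums

open Finset

/-- Additivity on coprime positive arguments, for functions with values in an arbitrary additive
monoid. The value at `0` is irrelevant. -/
def IsCoprimeAdditive {M : Type*} [Add M] (θ : ℕ → M) : Prop :=
  ∀ m n : ℕ, 0 < m → 0 < n → m.Coprime n → θ (m * n) = θ m + θ n

theorem IsCoprimeAdditive.map_one {M : Type*} [AddLeftCancelMonoid M] {θ : ℕ → M}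
    (hθ : IsCoprimeAdditive θ) : θ 1 = 0 := by
  simpa using hθ 1 1 one_pos one_pos (Nat.coprime_one_left 1)

theorem isCoprimeAdditive_log : IsCoprimeAdditive fun n : ℕ => Real.log n := by
  intro m n hm hn _
  simpa using Real.log_mul (Nat.cast_ne_zero.2 hm.ne') (Nat.cast_ne_zero.2 hn.ne')

/-- The prime powers `p ^ ν` with `ν ≥ 1` dividing `D`: the index set of the moments of an
additive function on the divisors of `D`. -/
def primePowerDivisors (D : ℕ) : Finset ℕ :=
  {q ∈ D.divisors | IsPrimePow q}

theorem sum_divisors_mul_of_coprime {M : Type*} [AddCommMonoid M] {a b : ℕ} (hab : a.Coprime b)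
    (f : ℕ → M) :
    ∑ d ∈ (a * b).divisors, f d = ∑ d ∈ a.divisors, ∑ e ∈ b.divisors, f (d * e) := by
  rw [Nat.divisors_mul, mul_def, sum_image hab.mul_injOn_divisors, sum_product]

theorem sum_primePowerDivisors_mul_of_coprime {M : Type*} [AddCommMonoid M] {a b : ℕ}
    (hab : a.Coprime b) (f : ℕ → M) :
    ∑ q ∈ primePowerDivisors (a * b), f q =
      ∑ q ∈ primePowerDivisors a, f q + ∑ q ∈ primePowerDivisors b, f q := by
  rw [primePowerDivisors, Nat.mul_divisors_filter_prime_pow hab, filter_union, sum_union]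
  · rfl
  · rw [disjoint_left]
    intro q hqa hqb
    simp only [mem_filter, Nat.mem_divisors] at hqa hqb
    exact hqa.2.ne_one (Nat.eq_one_of_dvd_coprimes hab hqa.1.1 hqb.1.1)

theorem sum_divisors_prime_pow_eq_add {M : Type*} [AddCommMonoid M] {p : ℕ} (hp : p.Prime) (k : ℕ)
    (f : ℕ → M) :
    ∑ d ∈ (p ^ k).divisors, f d = f 1 + ∑ q ∈ primePowerDivisors (p ^ k), f q := by
  have filter_ne_one : primePowerDivisors (p ^ k) = (p ^ k).divisors.erase 1 := by
    ext q
    simp only [primePowerDivisors, mem_filter, mem_erase, Nat.mem_divisors]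
    refine ⟨fun h => ⟨h.2.ne_one, h.1⟩, fun h => ⟨h.2, ?_⟩⟩
    obtain ⟨j, -, rfl⟩ := (Nat.dvd_prime_pow hp).1 h.2.1
    exact hp.isPrimePow.pow fun hj => h.1 (by rw [hj, pow_zero])
  rw [filter_ne_one, add_sum_erase _ _ (Nat.one_mem_divisors.2 (pow_ne_zero k hp.ne_zero))]

theorem exists_coprime_mul_of_primes (P : ℕ → Prop) {D : ℕ} (hD : D ≠ 0) :
    ∃ a b : ℕ, a.Coprime b ∧ a * b = D ∧ (∀ p, p.Prime → p ∣ a → P p) ∧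
      ∀ p, p.Prime → p ∣ b → ¬ P p := by
  induction D using Nat.recOnPrimeCoprime with
  | zero => exact absurd rfl hD
  | prime_pow p k hp =>
    have eq_of_dvd : ∀ r, r.Prime → r ∣ p ^ k → r = p := fun r hr h =>
      (Nat.prime_dvd_prime_iff_eq hr hp).1 (hr.dvd_of_dvd_pow h)
    by_cases hP : P p
    · exact ⟨p ^ k, 1, Nat.coprime_one_right _, mul_one _, fun r hr h => eq_of_dvd r hr h ▸ hP,
        fun r hr h => absurd h hr.not_dvd_one⟩
    · exact ⟨1, p ^ k, Nat.coprime_one_left _, one_mul _, fun r hr h => absurd h hr.not_dvd_one,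
        fun r hr h => eq_of_dvd r hr h ▸ hP⟩
  | coprime m n hm hn hmn ihm ihn =>
    obtain ⟨a, b, hab, rfl, ha, hb⟩ := ihm (by lia)
    obtain ⟨c, d, hcd, rfl, hc, hd⟩ := ihn (by lia)
    refine ⟨a * c, b * d, ?_, mul_mul_mul_comm a c b d, fun p hp h => ?_, fun p hp h => ?_⟩
    · exact (hab.mul_right hmn.coprime_mul_right.coprime_mul_left_right).mul_left
        (hmn.symm.coprime_mul_right.coprime_mul_left_right.mul_right hcd)
    · exact (hp.dvd_mul.1 h).elim (ha p hp) (hc p hp)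
    · exact (hp.dvd_mul.1 h).elim (hb p hp) (hd p hp)

theorem primePowerDivisors_subset_filter_minFac (P : ℕ → Prop) [DecidablePred P] {c D : ℕ}
    (hD : D ≠ 0) (hcD : c ∣ D) (hP : ∀ p, p.Prime → p ∣ c → P p) :
    primePowerDivisors c ⊆ {q ∈ primePowerDivisors D | P q.minFac} := by
  intro q hq
  rw [primePowerDivisors, mem_filter] at hq
  refine mem_filter.2 ⟨mem_filter.2 ⟨Nat.divisors_subset_of_dvd hD hcD hq.1, hq.2⟩, ?_⟩
  exact hP _ (Nat.minFac_prime hq.2.ne_one)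
    ((Nat.minFac_dvd q).trans (Nat.dvd_of_mem_divisors hq.1))

end DivisorSums

section DivisorMoments

open Finset

/-- The total mass of the divisors of `D` for the weight `w`. -/
def divisorMass (w : ArithmeticFunction ℝ) (D : ℕ) : ℝ :=
  ∑ d ∈ D.divisors, w d

/-- The approximate mean of an additive function `θ` over the divisors of `D`, in which the
probability that `q` is a component of a divisor is replaced by `w q`. -/
def approxMean {M : Type*} [AddCommMonoid M] [Module ℝ M] (w : ArithmeticFunction ℝ) (θ : ℕ → M)
    (D : ℕ) : M :=
  ∑ q ∈ primePowerDivisors D, w q • θ q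

/-- The second moment of `θ` over the prime powers dividing `D`, the approximate variance of an
additive function `θ` over the divisors of `D`. -/
def approxVariance {E : Type*} [Norm E] (w : ArithmeticFunction ℝ) (θ : ℕ → E) (D : ℕ) : ℝ :=
  ∑ q ∈ primePowerDivisors D, w q * ‖θ q‖ ^ 2

/-- The factor that controls the distance between `approxMean` and the true mean over the divisors
of `D`: quadratic in the weight of a prime, linear in that of a higher prime power. -/
noncomputable def biasFactor (w : ArithmeticFunction ℝ) (D : ℕ) : ℝ :=
  ∑ q ∈ primePowerDivisors D, if q.Prime then w q ^ 2 else w q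

theorem sum_sum_mul_norm_add_sq {ι κ E : Type*} [NormedAddCommGroup E] [InnerProductSpace ℝ E]
    (s : Finset ι) (t : Finset κ) (v : ι → ℝ) (w : κ → ℝ) (f : ι → E) (g : κ → E) :
    ∑ i ∈ s, ∑ j ∈ t, v i * w j * ‖f i + g j‖ ^ 2 =
      (∑ j ∈ t, w j) * ∑ i ∈ s, v i * ‖f i‖ ^ 2 + (∑ i ∈ s, v i) * ∑ j ∈ t, w j * ‖g j‖ ^ 2 +
        2 * inner ℝ (∑ i ∈ s, v i • f i) (∑ j ∈ t, w j • g j) := by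
  rw [sum_inner]
  simp only [inner_sum, real_inner_smul_left, real_inner_smul_right, sum_mul_sum]
  rw [sum_comm (s := t)]
  simp only [mul_sum, ← sum_add_distrib]
  exact sum_congr rfl fun i _ => sum_congr rfl fun j _ => by
    rw [norm_add_sq_real]
    ring

theorem sum_sum_mul_smul_add {ι κ R M : Type*} [CommSemiring R] [AddCommMonoid M] [Module R M]
    (s : Finset ι) (t : Finset κ) (v : ι → R) (w : κ → R) (f : ι → M) (g : κ → M) :
    ∑ i ∈ s, ∑ j ∈ t, (v i * w j) • (f i + g j) =
      (∑ j ∈ t, w j) • ∑ i ∈ s, v i • f i + (∑ i ∈ s, v i) • ∑ j ∈ t, w j • g j := by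
  simp only [sum_smul_sum]
  rw [sum_comm (s := t)]
  simp only [smul_smul, smul_add, sum_add_distrib, mul_comm (w _)]

variable {w : ArithmeticFunction ℝ} {a b p : ℕ}

theorem sum_divisors_smul_of_coprime {M : Type*} [AddCommMonoid M] [Module ℝ M]
    (hw : w.IsMultiplicative) (hab : a.Coprime b) (f : ℕ → M) :
    ∑ d ∈ (a * b).divisors, w d • f d =
      ∑ d ∈ a.divisors, ∑ e ∈ b.divisors, (w d * w e) • f (d * e) := by
  rw [sum_divisors_mul_of_coprime hab]
  refine sum_congr rfl fun d hd => sum_congr rfl fun e he => ?_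
  rw [hw.map_mul_of_coprime
    (hab.of_dvd (Nat.dvd_of_mem_divisors hd) (Nat.dvd_of_mem_divisors he))]

theorem IsCoprimeAdditive.sub_add_eq {M : Type*} [AddCommGroup M] {θ : ℕ → M}
    (hθ : IsCoprimeAdditive θ) (hab : a.Coprime b) {d e : ℕ} (hd : d ∈ a.divisors)
    (he : e ∈ b.divisors) (x y : M) : θ (d * e) - (x + y) = θ d - x + (θ e - y) := by
  rw [hθ d e (Nat.pos_of_mem_divisors hd) (Nat.pos_of_mem_divisors he)
    (hab.of_dvd (Nat.dvd_of_mem_divisors hd) (Nat.dvd_of_mem_divisors he)), add_sub_add_comm]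

theorem divisorMass_nonneg (hw0 : ∀ n, 0 ≤ w n) (D : ℕ) : 0 ≤ divisorMass w D :=
  sum_nonneg fun _ _ => hw0 _

theorem approxVariance_nonneg {E : Type*} [SeminormedAddGroup E] (hw0 : ∀ n, 0 ≤ w n) (θ : ℕ → E)
    (D : ℕ) : 0 ≤ approxVariance w θ D :=
  sum_nonneg fun _ _ => mul_nonneg (hw0 _) (sq_nonneg _)

theorem biasFactor_nonneg (hw0 : ∀ n, 0 ≤ w n) (D : ℕ) : 0 ≤ biasFactor w D :=
  sum_nonneg fun q _ => by
    split_ifs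
    exacts [sq_nonneg _, hw0 q]

theorem divisorMass_mul_of_coprime (hw : w.IsMultiplicative) (hab : a.Coprime b) :
    divisorMass w (a * b) = divisorMass w a * divisorMass w b := by
  simpa [divisorMass, sum_mul_sum] using sum_divisors_smul_of_coprime hw hab fun _ => (1 : ℝ)

theorem approxMean_mul_of_coprime {M : Type*} [AddCommMonoid M] [Module ℝ M] (hab : a.Coprime b)
    (θ : ℕ → M) : approxMean w θ (a * b) = approxMean w θ a + approxMean w θ b :=
  sum_primePowerDivisors_mul_of_coprime hab _

theorem approxVariance_mul_of_coprime {E : Type*} [Norm E] (hab : a.Coprime b) (θ : ℕ → E) :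
    approxVariance w θ (a * b) = approxVariance w θ a + approxVariance w θ b :=
  sum_primePowerDivisors_mul_of_coprime hab _

theorem biasFactor_mul_of_coprime (hab : a.Coprime b) :
    biasFactor w (a * b) = biasFactor w a + biasFactor w b :=
  sum_primePowerDivisors_mul_of_coprime hab _

theorem sum_divisors_smul_sub_of_coprime {M : Type*} [AddCommGroup M] [Module ℝ M]
    (hw : w.IsMultiplicative) (hab : a.Coprime b) {θ : ℕ → M} (hθ : IsCoprimeAdditive θ)
    (x y : M) :
    ∑ d ∈ (a * b).divisors, w d • (θ d - (x + y)) =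
      divisorMass w b • ∑ d ∈ a.divisors, w d • (θ d - x) +
        divisorMass w a • ∑ e ∈ b.divisors, w e • (θ e - y) := by
  rw [sum_divisors_smul_of_coprime hw hab, divisorMass, divisorMass, ← sum_sum_mul_smul_add]
  exact sum_congr rfl fun d hd => sum_congr rfl fun e he => by rw [hθ.sub_add_eq hab hd he]

theorem sum_divisors_mul_norm_sub_sq_of_coprime {E : Type*} [NormedAddCommGroup E]
    [InnerProductSpace ℝ E] (hw : w.IsMultiplicative) (hab : a.Coprime b) {θ : ℕ → E}
    (hθ : IsCoprimeAdditive θ) (x y : E) :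
    ∑ d ∈ (a * b).divisors, w d * ‖θ d - (x + y)‖ ^ 2 =
      divisorMass w b * ∑ d ∈ a.divisors, w d * ‖θ d - x‖ ^ 2 +
        divisorMass w a * ∑ e ∈ b.divisors, w e * ‖θ e - y‖ ^ 2 +
          2 * inner ℝ (∑ d ∈ a.divisors, w d • (θ d - x)) (∑ e ∈ b.divisors, w e • (θ e - y)) := by
  simp only [← smul_eq_mul (w _)]
  rw [sum_divisors_smul_of_coprime hw hab]
  simp only [smul_eq_mul]
  rw [divisorMass, divisorMass, ← sum_sum_mul_norm_add_sq]
  exact sum_congr rfl fun d hd => sum_congr rfl fun e he => by rw [hθ.sub_add_eq hab hd he]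

theorem divisorMass_prime_pow (hw : w.IsMultiplicative) (hp : p.Prime) (k : ℕ) :
    divisorMass w (p ^ k) = 1 + ∑ q ∈ primePowerDivisors (p ^ k), w q := by
  rw [divisorMass, sum_divisors_prime_pow_eq_add hp, hw.map_one]

theorem divisorMass_le_exp (hw : w.IsMultiplicative) (hw0 : ∀ n, 0 ≤ w n) (D : ℕ) :
    divisorMass w D ≤ Real.exp (∑ q ∈ primePowerDivisors D, w q) := by
  induction D using Nat.recOnPrimeCoprime with
  | zero => simp [divisorMass, primePowerDivisors]
  | prime_pow p k hp =>
    rw [divisorMass_prime_pow hw hp, add_comm]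
    exact Real.add_one_le_exp _
  | coprime a b _ _ hab iha ihb =>
    rw [divisorMass_mul_of_coprime hw hab, sum_primePowerDivisors_mul_of_coprime hab, Real.exp_add]
    exact mul_le_mul iha ihb (divisorMass_nonneg hw0 b) (Real.exp_nonneg _)

theorem sum_divisors_mul_le_divisorMass_mul (hw : w.IsMultiplicative) (hw0 : ∀ n, 0 ≤ w n)
    {f : ℕ → ℝ} (hf : IsCoprimeAdditive f) (hf0 : ∀ n, 0 ≤ f n) (D : ℕ) :
    ∑ d ∈ D.divisors, w d * f d ≤ divisorMass w D * ∑ q ∈ primePowerDivisors D, w q * f q := by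
  induction D using Nat.recOnPrimeCoprime with
  | zero => simp [divisorMass]
  | prime_pow p k hp =>
    rw [divisorMass_prime_pow hw hp, sum_divisors_prime_pow_eq_add hp, hf.map_one, mul_zero,
      zero_add]
    exact le_mul_of_one_le_left (sum_nonneg fun q _ => mul_nonneg (hw0 q) (hf0 q))
      (le_add_of_nonneg_right (sum_nonneg fun q _ => hw0 q))
  | coprime a b _ _ hab iha ihb =>
    have sum_mul : ∑ d ∈ (a * b).divisors, w d * f d =
        divisorMass w b * ∑ d ∈ a.divisors, w d * f d +
          divisorMass w a * ∑ e ∈ b.divisors, w e * f e := by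
      simpa using sum_divisors_smul_sub_of_coprime hw hab hf 0 0
    rw [sum_mul, divisorMass_mul_of_coprime hw hab, sum_primePowerDivisors_mul_of_coprime hab]
    linarith [mul_le_mul_of_nonneg_left iha (divisorMass_nonneg hw0 b),
      mul_le_mul_of_nonneg_left ihb (divisorMass_nonneg hw0 a)]

/-- Markov's inequality for `log d`. -/
theorem divisorMass_le_two_mul_sum_Icc (hw : w.IsMultiplicative) (hw0 : ∀ n, 0 ≤ w n) {N D : ℕ}
    (hN : N ≠ 0)
    (hD : ∑ q ∈ primePowerDivisors D, w q * Real.log q ≤ Real.log (N + 1) / 2) :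
    divisorMass w D ≤ 2 * ∑ n ∈ Icc 1 N, w n := by
  have log_pos : 0 < Real.log (N + 1) := Real.log_pos (by simpa using Nat.pos_of_ne_zero hN)
  have small_le : ∑ d ∈ D.divisors with d ≤ N, w d ≤ ∑ n ∈ Icc 1 N, w n := by
    refine sum_le_sum_of_subset_of_nonneg (fun d hd => ?_) fun n _ _ => hw0 n
    rw [mem_filter] at hd
    exact mem_Icc.2 ⟨Nat.pos_of_mem_divisors hd.1, hd.2⟩
  have large_le : Real.log (N + 1) * ∑ d ∈ D.divisors with ¬ d ≤ N, w d ≤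
      Real.log (N + 1) * (divisorMass w D / 2) :=
    calc Real.log (N + 1) * ∑ d ∈ D.divisors with ¬ d ≤ N, w d
        = ∑ d ∈ D.divisors with ¬ d ≤ N, w d * Real.log (N + 1) := by rw [mul_comm, sum_mul]
      _ ≤ ∑ d ∈ D.divisors with ¬ d ≤ N, w d * Real.log d := sum_le_sum fun d hd =>
          mul_le_mul_of_nonneg_left (Real.log_le_log (by positivity)
            (by exact_mod_cast not_le.1 (mem_filter.1 hd).2)) (hw0 d)
      _ ≤ ∑ d ∈ D.divisors, w d * Real.log d :=
          sum_le_sum_of_subset_of_nonneg (filter_subset _ _) fun d _ _ =>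
            mul_nonneg (hw0 d) (Real.log_natCast_nonneg d)
      _ ≤ divisorMass w D * ∑ q ∈ primePowerDivisors D, w q * Real.log q :=
          sum_divisors_mul_le_divisorMass_mul hw hw0 isCoprimeAdditive_log
            Real.log_natCast_nonneg D
      _ ≤ divisorMass w D * (Real.log (N + 1) / 2) :=
          mul_le_mul_of_nonneg_left hD (divisorMass_nonneg hw0 D)
      _ = Real.log (N + 1) * (divisorMass w D / 2) := by ring
  have split : divisorMass w D =
      ∑ d ∈ D.divisors with d ≤ N, w d + ∑ d ∈ D.divisors with ¬ d ≤ N, w d :=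
    (sum_filter_add_sum_filter_not _ _ _).symm
  linarith [le_of_mul_le_mul_left large_le log_pos]

variable {E : Type*} [NormedAddCommGroup E] [InnerProductSpace ℝ E] {θ : ℕ → E}

theorem norm_approxMean_sq_le (hw0 : ∀ n, 0 ≤ w n) (θ : ℕ → E) (D : ℕ) :
    ‖approxMean w θ D‖ ^ 2 ≤ (∑ q ∈ primePowerDivisors D, w q) * approxVariance w θ D := by
  have triangle : ‖approxMean w θ D‖ ≤ ∑ q ∈ primePowerDivisors D, w q * ‖θ q‖ :=
    (norm_sum_le _ _).trans_eq <| sum_congr rfl fun q _ => by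
      rw [norm_smul, Real.norm_of_nonneg (hw0 q)]
  refine (pow_le_pow_left₀ (norm_nonneg _) triangle 2).trans ?_
  exact sum_sq_le_sum_mul_sum_of_sq_le_mul _ (fun q _ => hw0 q)
    (fun q _ => mul_nonneg (hw0 q) (sq_nonneg _)) fun q _ => le_of_eq (by ring)

theorem sum_divisors_prime_pow_smul_sub_approxMean (hw : w.IsMultiplicative) (hp : p.Prime) (k : ℕ)
    (hθ : IsCoprimeAdditive θ) :
    ∑ d ∈ (p ^ k).divisors, w d • (θ d - approxMean w θ (p ^ k)) =
      -((∑ q ∈ primePowerDivisors (p ^ k), w q) • approxMean w θ (p ^ k)) := by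
  rw [sum_divisors_prime_pow_eq_add hp, hw.map_one, hθ.map_one]
  simp only [smul_sub, sum_sub_distrib, ← sum_smul]
  rw [← approxMean]
  module

theorem sum_divisors_prime_pow_mul_norm_sub_approxMean_sq (hw : w.IsMultiplicative) (hp : p.Prime)
    (k : ℕ) (hθ : IsCoprimeAdditive θ) :
    ∑ d ∈ (p ^ k).divisors, w d * ‖θ d - approxMean w θ (p ^ k)‖ ^ 2 =
      approxVariance w θ (p ^ k) +
        (∑ q ∈ primePowerDivisors (p ^ k), w q - 1) * ‖approxMean w θ (p ^ k)‖ ^ 2 := by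
  have sum_inner_approxMean :
      ∑ q ∈ primePowerDivisors (p ^ k), w q * inner ℝ (θ q) (approxMean w θ (p ^ k)) =
        ‖approxMean w θ (p ^ k)‖ ^ 2 := by
    rw [← real_inner_self_eq_norm_sq]
    nth_rw 2 [approxMean]
    simp only [sum_inner, real_inner_smul_left]
  rw [sum_divisors_prime_pow_eq_add hp, hw.map_one, hθ.map_one, zero_sub, norm_neg, one_mul]
  simp only [norm_sub_sq_real, mul_add, mul_sub, sum_add_distrib, sum_sub_distrib,
    mul_left_comm _ (2 : ℝ), ← mul_sum, ← sum_mul, sum_inner_approxMean]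
  rw [← approxVariance]
  ring

theorem sq_sum_le_one_add_mul_biasFactor (hw0 : ∀ n, 0 ≤ w n) (hp : p.Prime) (k : ℕ) :
    (∑ q ∈ primePowerDivisors (p ^ k), w q) ^ 2 ≤
      (1 + ∑ q ∈ primePowerDivisors (p ^ k), w q) * biasFactor w (p ^ k) := by
  have eq_of_prime : ∀ q ∈ primePowerDivisors (p ^ k), q.Prime → q = p := fun q hq hq' =>
    (Nat.prime_dvd_prime_iff_eq hq' hp).1
      (hq'.dvd_of_dvd_pow (Nat.dvd_of_mem_divisors (mem_filter.1 hq).1))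
  have prime_sq_le : (∑ q ∈ primePowerDivisors (p ^ k) with q.Prime, w q) ^ 2 ≤
      ∑ q ∈ primePowerDivisors (p ^ k) with q.Prime, w q ^ 2 := by
    have card_le : #{q ∈ primePowerDivisors (p ^ k) | q.Prime} ≤ 1 := card_le_one.2 fun q hq r hr =>
      (eq_of_prime q (mem_filter.1 hq).1 (mem_filter.1 hq).2).trans
        (eq_of_prime r (mem_filter.1 hr).1 (mem_filter.1 hr).2).symm
    exact sq_sum_le_card_mul_sum_sq.trans
      (mul_le_of_le_one_left (sum_nonneg fun _ _ => sq_nonneg _) (by exact_mod_cast card_le))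
  rw [biasFactor, sum_ite, ← sum_filter_add_sum_filter_not _ Nat.Prime w]
  set s := ∑ q ∈ primePowerDivisors (p ^ k) with q.Prime, w q
  set t := ∑ q ∈ primePowerDivisors (p ^ k) with ¬ q.Prime, w q
  have hs : 0 ≤ s := sum_nonneg fun q _ => hw0 q
  have ht : 0 ≤ t := sum_nonneg fun q _ => hw0 q
  calc (s + t) ^ 2 ≤ (1 + (s + t)) * (s ^ 2 + t) := by
        linarith [mul_nonneg ht (sq_nonneg (s - 1)), mul_nonneg ht hs, pow_nonneg hs 3]
    _ ≤ _ := by gcongr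

theorem two_mul_mul_le_of_sq_le_mul {x y a b c d : ℝ} (ha : 0 ≤ a) (hb : 0 ≤ b) (hc : 0 ≤ c)
    (hd : 0 ≤ d) (hx : x ^ 2 ≤ a * b) (hy : y ^ 2 ≤ c * d) : 2 * (x * y) ≤ a * d + c * b := by
  refine le_of_abs_le (abs_le_of_sq_le_sq ?_ (by positivity))
  calc (2 * (x * y)) ^ 2 = 4 * (x ^ 2 * y ^ 2) := by ring
    _ ≤ 4 * ((a * b) * (c * d)) := by gcongr
    _ = 4 * (a * d) * (c * b) := by ring
    _ ≤ (a * d + c * b) ^ 2 := four_mul_le_sq_add _ _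

/-- Divided by the mass, the vector on the left is additive over coprime factors, so that
Cauchy–Schwarz combines the bounds for the two factors. -/
theorem norm_sum_divisors_smul_sub_approxMean_sq_le (hw : w.IsMultiplicative)
    (hw0 : ∀ n, 0 ≤ w n) (hθ : IsCoprimeAdditive θ) (D : ℕ) :
    ‖∑ d ∈ D.divisors, w d • (θ d - approxMean w θ D)‖ ^ 2 ≤
      divisorMass w D * biasFactor w D * (divisorMass w D * approxVariance w θ D) := by
  induction D using Nat.recOnPrimeCoprime with
  | zero => simp [divisorMass]
  | prime_pow p k hp =>
    have bias_ge := sq_sum_le_one_add_mul_biasFactor hw0 hp k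
    have mean_le := norm_approxMean_sq_le hw0 θ (p ^ k)
    have variance_nonneg := approxVariance_nonneg hw0 θ (p ^ k)
    rw [sum_divisors_prime_pow_smul_sub_approxMean hw hp k hθ, norm_neg, norm_smul, mul_pow,
      Real.norm_eq_abs, sq_abs, divisorMass_prime_pow hw hp]
    refine mul_le_mul bias_ge (mean_le.trans ?_) (sq_nonneg _) ((sq_nonneg _).trans bias_ge)
    gcongr
    exact le_add_of_nonneg_left zero_le_one
  | coprime a b _ _ hab iha ihb =>
    have mass_a := divisorMass_nonneg hw0 a
    have mass_b := divisorMass_nonneg hw0 b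
    have cross := two_mul_mul_le_of_sq_le_mul (mul_nonneg mass_a (biasFactor_nonneg hw0 a))
      (mul_nonneg mass_a (approxVariance_nonneg hw0 θ a))
      (mul_nonneg mass_b (biasFactor_nonneg hw0 b))
      (mul_nonneg mass_b (approxVariance_nonneg hw0 θ b)) iha ihb
    rw [approxMean_mul_of_coprime hab, sum_divisors_smul_sub_of_coprime hw hab hθ,
      divisorMass_mul_of_coprime hw hab, biasFactor_mul_of_coprime hab,
      approxVariance_mul_of_coprime hab]
    set β := ∑ d ∈ a.divisors, w d • (θ d - approxMean w θ a)
    set γ := ∑ d ∈ b.divisors, w d • (θ d - approxMean w θ b)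
    have triangle : ‖divisorMass w b • β + divisorMass w a • γ‖ ≤
        divisorMass w b * ‖β‖ + divisorMass w a * ‖γ‖ := by
      simpa [norm_smul, abs_of_nonneg mass_a, abs_of_nonneg mass_b] using
        norm_add_le (divisorMass w b • β) (divisorMass w a • γ)
    refine (pow_le_pow_left₀ (norm_nonneg _) triangle 2).trans ?_
    linarith [mul_le_mul_of_nonneg_left iha (sq_nonneg (divisorMass w b)),
      mul_le_mul_of_nonneg_left ihb (sq_nonneg (divisorMass w a)),
      mul_le_mul_of_nonneg_left cross (mul_nonneg mass_a mass_b)]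

theorem sum_divisors_mul_norm_sub_approxMean_sq_le (hw : w.IsMultiplicative) (hw0 : ∀ n, 0 ≤ w n)
    (hθ : IsCoprimeAdditive θ) (D : ℕ) :
    ∑ d ∈ D.divisors, w d * ‖θ d - approxMean w θ D‖ ^ 2 ≤
      divisorMass w D * ((1 + biasFactor w D) * approxVariance w θ D) := by
  induction D using Nat.recOnPrimeCoprime with
  | zero => simp [divisorMass]
  | prime_pow p k hp =>
    have bias_ge := sq_sum_le_one_add_mul_biasFactor hw0 hp k
    have mean_le := norm_approxMean_sq_le hw0 θ (p ^ k)
    have variance_nonneg := approxVariance_nonneg hw0 θ (p ^ k)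
    rw [sum_divisors_prime_pow_mul_norm_sub_approxMean_sq hw hp k hθ, divisorMass_prime_pow hw hp]
    set s := ∑ q ∈ primePowerDivisors (p ^ k), w q
    have hs : 0 ≤ s := sum_nonneg fun q _ => hw0 q
    linarith [mul_le_mul_of_nonneg_left mean_le hs, mul_nonneg hs variance_nonneg,
      sq_nonneg ‖approxMean w θ (p ^ k)‖, mul_le_mul_of_nonneg_right bias_ge variance_nonneg]
  | coprime a b _ _ hab iha ihb =>
    have mass_a := divisorMass_nonneg hw0 a
    have mass_b := divisorMass_nonneg hw0 b
    have cross := two_mul_mul_le_of_sq_le_mul (mul_nonneg mass_a (biasFactor_nonneg hw0 a))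
      (mul_nonneg mass_a (approxVariance_nonneg hw0 θ a))
      (mul_nonneg mass_b (biasFactor_nonneg hw0 b))
      (mul_nonneg mass_b (approxVariance_nonneg hw0 θ b))
      (norm_sum_divisors_smul_sub_approxMean_sq_le hw hw0 hθ a)
      (norm_sum_divisors_smul_sub_approxMean_sq_le hw hw0 hθ b)
    rw [approxMean_mul_of_coprime hab, sum_divisors_mul_norm_sub_sq_of_coprime hw hab hθ,
      divisorMass_mul_of_coprime hw hab, biasFactor_mul_of_coprime hab,
      approxVariance_mul_of_coprime hab]
    linarith [mul_le_mul_of_nonneg_left iha mass_b, mul_le_mul_of_nonneg_left ihb mass_a,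
      real_inner_le_norm (∑ d ∈ a.divisors, w d • (θ d - approxMean w θ a))
        (∑ d ∈ b.divisors, w d • (θ d - approxMean w θ b))]

end DivisorMoments

section LogWeights

open Finset

theorem dvd_lcmUpto_of_le {n N : ℕ} (hn : n ≠ 0) (hnN : n ≤ N) : n ∣ N.lcmUpto :=
  dvd_lcm (f := id) (mem_Icc.2 ⟨Nat.one_le_iff_ne_zero.2 hn, hnN⟩)

theorem primePowerDivisors_lcmUpto (N : ℕ) :
    primePowerDivisors N.lcmUpto = {q ∈ Icc 1 N | IsPrimePow q} := by
  ext q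
  simp only [primePowerDivisors, mem_filter, Nat.mem_divisors, mem_Icc, and_congr_left_iff]
  intro hq
  refine ⟨fun h => ⟨hq.pos, ?_⟩, fun h => ⟨dvd_lcmUpto_of_le hq.ne_zero h.2, N.lcmUpto_ne_zero⟩⟩
  obtain ⟨p, k, hp, hk, rfl⟩ := (isPrimePow_nat_iff q).1 hq
  have exponent_le := (hp.pow_dvd_iff_le_factorization N.lcmUpto_ne_zero).1 h.1
  rw [N.factorization_lcmUpto hp] at exponent_le
  exact Nat.pow_le_of_le_log (by rintro rfl; simp at exponent_le; lia) exponent_le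

theorem half_le_log_of_two_le {n : ℕ} (hn : 2 ≤ n) : 1 / 2 ≤ Real.log n := by
  have := Real.log_le_log two_pos (by exact_mod_cast hn : (2 : ℝ) ≤ n)
  linarith [Real.log_two_gt_d9]

/-- Keep only the primes in `log N! = ∑ d ≤ N, Λ d * ⌊N / d⌋`. -/
theorem sum_log_div_primesLE_le {N : ℕ} (hN : N ≠ 0) :
    ∑ p ∈ N.primesLE, Real.log p / p ≤ Real.log N + Real.log 4 := by
  open ArithmeticFunction in
  have sum_floor_mul_log_le : ∑ p ∈ N.primesLE, Real.log p * (N / p : ℕ) ≤ N * Real.log N :=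
    calc ∑ p ∈ N.primesLE, Real.log p * (N / p : ℕ)
        = ∑ p ∈ N.primesLE, vonMangoldt p * (N / p : ℕ) := sum_congr rfl fun p hp => by
          rw [vonMangoldt_apply_prime (Nat.prime_of_mem_primesLE hp)]
      _ ≤ ∑ n ∈ Ioc 0 N, vonMangoldt n * (N / n : ℕ) := by
          rw [Nat.primesLE_eq_filter_Ioc_zero]
          exact sum_le_sum_of_subset_of_nonneg (filter_subset _ _) fun n _ _ =>
            mul_nonneg vonMangoldt_nonneg (Nat.cast_nonneg _)
      _ = ∑ n ∈ Ioc 0 N, Real.log n := by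
          simpa [vonMangoldt_mul_zeta] using (sum_Ioc_mul_zeta_eq_sum vonMangoldt N).symm
      _ ≤ ∑ _n ∈ Ioc 0 N, Real.log N := sum_le_sum fun n hn => by
          have := mem_Ioc.1 hn
          exact Real.log_le_log (by exact_mod_cast this.1) (by exact_mod_cast this.2)
      _ = N * Real.log N := by simp
  have theta_le : ∑ p ∈ N.primesLE, Real.log p ≤ Real.log 4 * N := by
    simpa [Chebyshev.theta_eq_sum_primesLE_log] using
      Chebyshev.theta_le_log4_mul_x (Nat.cast_nonneg N)
  have floor_ge : ∀ p ∈ N.primesLE,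
      N * (Real.log p / p) ≤ Real.log p * (N / p : ℕ) + Real.log p := fun p _ => by
    have := Nat.lt_floor_add_one ((N : ℝ) / p)
    rw [Nat.floor_div_eq_div] at this
    calc N * (Real.log p / p) = Real.log p * (N / p) := by ring
      _ ≤ Real.log p * ((N / p : ℕ) + 1) := by gcongr
      _ = _ := by ring
  have sum_floor_ge := sum_le_sum floor_ge
  rw [sum_add_distrib, ← mul_sum] at sum_floor_ge
  have hN0 : (0 : ℝ) < N := by positivity
  refine le_of_mul_le_mul_left ?_ hN0
  linarith

theorem sum_log_div_primesLE_le_three_mul_log (N : ℕ) :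
    ∑ p ∈ N.primesLE, Real.log p / p ≤ 3 * Real.log N := by
  rcases lt_or_ge N 2 with hN | hN
  · have primesLE_eq_empty : N.primesLE = ∅ := by
      rw [Nat.primesLE_eq_filter_Icc_two, Icc_eq_empty_of_lt hN, filter_empty]
    rw [primesLE_eq_empty, sum_empty]
    exact mul_nonneg (by norm_num) (Real.log_natCast_nonneg N)
  · have log_four_le : Real.log 4 ≤ 2 * Real.log N := by
      rw [show (4 : ℝ) = 2 ^ 2 by norm_num, Real.log_pow]
      exact mul_le_mul_of_nonneg_left
        (Real.log_le_log two_pos (by exact_mod_cast hN)) zero_le_two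
    linarith [sum_log_div_primesLE_le (N := N) (by lia)]

end LogWeights

section MultiplicativeClass

open Finset

/-- The weight `l n / n` of the logarithmic means of `l`. -/
noncomputable def logWeight (l : ArithmeticFunction ℝ) : ArithmeticFunction ℝ :=
  l.pdiv (ArithmeticFunction.id : ArithmeticFunction ℕ)

@[simp]
theorem logWeight_apply (l : ArithmeticFunction ℝ) (n : ℕ) : logWeight l n = l n / n :=
  rfl

theorem primePowerDivisors_lcmUpto_floor (x : ℝ) :
    primePowerDivisors ⌊x⌋₊.lcmUpto = primePowersUpTo x :=
  primePowerDivisors_lcmUpto _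

variable {x A B : ℝ} {l : ArithmeticFunction ℝ}

theorem logWeight_nonneg (hl : ∀ n, 0 ≤ l n) (n : ℕ) : 0 ≤ logWeight l n :=
  div_nonneg (hl n) (Nat.cast_nonneg n)

theorem isMultiplicative_logWeight (hl : l.IsMultiplicative) : (logWeight l).IsMultiplicative :=
  hl.pdiv ArithmeticFunction.isMultiplicative_id.natCast

theorem isPrimePow_of_mem_primePowersUpTo {q : ℕ} (hq : q ∈ primePowersUpTo x) : IsPrimePow q :=
  (mem_filter.1 hq).2

theorem half_le_log_of_mem_primePowersUpTo {q : ℕ} (hq : q ∈ primePowersUpTo x) :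
    1 / 2 ≤ Real.log q :=
  half_le_log_of_two_le (isPrimePow_of_mem_primePowersUpTo hq).two_le

namespace MemMultClass

variable (h : MemMultClass x A B l) (hl : ∀ n, 0 ≤ l n)

include h hl

theorem logWeight_prime_le {p : ℕ} (hp : p.Prime) (hpx : p ∈ primePowersUpTo x) :
    logWeight l p ≤ A / p := by
  have p_le : (p : ℝ) ≤ x :=
    (Nat.le_floor_iff' hp.ne_zero).1 (mem_Icc.1 (mem_filter.1 hpx).1).2
  have := h.norm_prime_le p hp p_le
  rw [Real.norm_of_nonneg (hl p)] at this
  exact div_le_div_of_nonneg_right this (Nat.cast_nonneg p)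

theorem sum_properPrimePowers_le :
    ∑ q ∈ properPrimePowersUpTo x, logWeight l q * Real.log q ≤ B := by
  refine (sum_congr rfl fun q _ => ?_).trans_le h.sum_le
  rw [Real.norm_of_nonneg (hl q), logWeight_apply, div_mul_eq_mul_div]

theorem sum_log_primes_le (hA : 0 ≤ A) {y : ℝ} (hy : 1 ≤ y) :
    ∑ p ∈ primePowersUpTo x with (p.minFac : ℝ) ≤ y ∧ p.Prime, logWeight l p * Real.log p ≤
      A * (3 * Real.log y) :=
  calc _ ≤ ∑ p ∈ primePowersUpTo x with (p.minFac : ℝ) ≤ y ∧ p.Prime, A * (Real.log p / p) :=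
        sum_le_sum fun p hp => by
        rw [mem_filter] at hp
        rw [mul_div_left_comm, mul_comm]
        exact mul_le_mul_of_nonneg_left (h.logWeight_prime_le hl hp.2.2 hp.1)
          (Real.log_natCast_nonneg p)
    _ ≤ ∑ p ∈ ⌊y⌋₊.primesLE, A * (Real.log p / p) := by
        refine sum_le_sum_of_subset_of_nonneg (fun p hp => ?_) fun p _ _ => by positivity
        rw [mem_filter] at hp
        exact Nat.mem_primesLE.2 ⟨Nat.le_floor (hp.2.2.minFac_eq ▸ hp.2.1), hp.2.2⟩
    _ ≤ A * (3 * Real.log ⌊y⌋₊) := by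
        rw [← mul_sum]
        gcongr
        exact sum_log_div_primesLE_le_three_mul_log _
    _ ≤ A * (3 * Real.log y) := by
        gcongr
        · exact_mod_cast Nat.floor_pos.2 hy
        · exact Nat.floor_le (by linarith)

theorem sum_log_of_minFac_le (hA : 0 ≤ A) (hB : 0 ≤ B) {y : ℝ} (hy : 1 ≤ y) :
    ∑ q ∈ primePowersUpTo x with (q.minFac : ℝ) ≤ y, logWeight l q * Real.log q ≤
      (3 * A + 2 * B) * Real.log y := by
  rcases lt_or_ge y 2 with hy2 | hy2
  · rw [sum_eq_zero]
    · exact mul_nonneg (by positivity) (Real.log_nonneg hy)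
    · intro q hq
      rw [mem_filter] at hq
      have minFac_prime := Nat.minFac_prime (isPrimePow_of_mem_primePowersUpTo hq.1).ne_one
      exact absurd (hq.2.trans_lt hy2) (by exact_mod_cast minFac_prime.two_le.not_gt)
  have proper_part_le : ∑ q ∈ primePowersUpTo x with (q.minFac : ℝ) ≤ y ∧ ¬ q.Prime,
      logWeight l q * Real.log q ≤ B := by
    refine le_trans (sum_le_sum_of_subset_of_nonneg (fun q hq => ?_) fun q _ _ => ?_)
      (h.sum_properPrimePowers_le hl)
    · rw [mem_filter] at hq
      exact mem_filter.2 ⟨hq.1, hq.2.2⟩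
    · exact mul_nonneg (logWeight_nonneg hl q) (Real.log_natCast_nonneg q)
  have half_le_log_y : 1 / 2 ≤ Real.log y :=
    (half_le_log_of_two_le le_rfl).trans (Real.log_le_log (by norm_num) (by exact_mod_cast hy2))
  rw [← sum_filter_add_sum_filter_not _ Nat.Prime, filter_filter, filter_filter]
  linarith [h.sum_log_primes_le hl hA hy, mul_le_mul_of_nonneg_left half_le_log_y hB]

theorem sum_log_primePowers_le (hA : 0 ≤ A) (hB : 0 ≤ B) :
    ∑ q ∈ primePowersUpTo x, logWeight l q * Real.log q ≤
      (3 * A + 2 * B) * Real.log (⌊x⌋₊ + 1) := by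
  have minFac_le : ∀ q ∈ primePowersUpTo x, (q.minFac : ℝ) ≤ ⌊x⌋₊ + 1 := fun q hq => by
    have q_le := (mem_Icc.1 (mem_filter.1 hq).1).2
    exact_mod_cast ((Nat.minFac_le (isPrimePow_of_mem_primePowersUpTo hq).pos).trans q_le).trans
      (Nat.le_succ _)
  have := h.sum_log_of_minFac_le hl hA hB (y := ⌊x⌋₊ + 1) (by simp)
  rwa [filter_true_of_mem minFac_le] at this

theorem sum_of_lt_minFac_le (hA : 0 ≤ A) (hB : 0 ≤ B) {y : ℝ} (hy : 1 < y) :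
    ∑ q ∈ primePowersUpTo x with ¬ (q.minFac : ℝ) ≤ y, logWeight l q ≤
      (3 * A + 2 * B) * Real.log (⌊x⌋₊ + 1) / Real.log y := by
  rw [le_div_iff₀ (Real.log_pos hy), sum_mul]
  refine le_trans ?_ (h.sum_log_primePowers_le hl hA hB)
  refine (sum_le_sum fun q hq => ?_).trans (sum_le_sum_of_subset_of_nonneg (filter_subset _ _)
    fun q _ _ => mul_nonneg (logWeight_nonneg hl q) (Real.log_natCast_nonneg q))
  rw [mem_filter, not_le] at hq
  have minFac_le : (q.minFac : ℝ) ≤ q :=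
    by exact_mod_cast Nat.minFac_le (isPrimePow_of_mem_primePowersUpTo hq.1).pos
  exact mul_le_mul_of_nonneg_left
    (Real.log_le_log (by linarith) (hq.2.le.trans minFac_le)) (logWeight_nonneg hl q)

theorem divisorMass_lcmUpto_le (hx : 1 ≤ x) (hA : 0 < A) (hB : 0 < B) :
    divisorMass (logWeight l) ⌊x⌋₊.lcmUpto ≤
      2 * Real.exp (2 * (3 * A + 2 * B) ^ 2) * ∑ n ∈ Icc 1 ⌊x⌋₊, logWeight l n := by
  have hw := isMultiplicative_logWeight h.isMultiplicative
  have hw0 := logWeight_nonneg hl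
  have floor_pos : 0 < ⌊x⌋₊ := Nat.floor_pos.2 hx
  set K := 3 * A + 2 * B
  have K_pos : 0 < K := by positivity
  set L := Real.log (⌊x⌋₊ + 1)
  have L_pos : 0 < L := Real.log_pos (by simpa using floor_pos)
  set y := Real.exp (L / (2 * K)) with hy
  have one_lt_y : 1 < y := Real.one_lt_exp_iff.2 (by positivity)
  obtain ⟨a, b, hab, hD, ha, hb⟩ :=
    exists_coprime_mul_of_primes (fun p => (p : ℝ) ≤ y) ⌊x⌋₊.lcmUpto_ne_zero
  have subset_a := primePowerDivisors_subset_filter_minFac (fun p => (p : ℝ) ≤ y)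
    ⌊x⌋₊.lcmUpto_ne_zero (Dvd.intro _ hD) ha
  have subset_b := primePowerDivisors_subset_filter_minFac (fun p => ¬ (p : ℝ) ≤ y)
    ⌊x⌋₊.lcmUpto_ne_zero (Dvd.intro_left _ hD) hb
  rw [primePowerDivisors_lcmUpto_floor] at subset_a subset_b
  have mass_a_le : divisorMass (logWeight l) a ≤ 2 * ∑ n ∈ Icc 1 ⌊x⌋₊, logWeight l n := by
    refine divisorMass_le_two_mul_sum_Icc hw hw0 floor_pos.ne' ?_
    have log_y_eq : K * Real.log y = L / 2 := by
      rw [hy, Real.log_exp]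
      field_simp
    refine le_trans ?_ ((h.sum_log_of_minFac_le hl hA.le hB.le one_lt_y.le).trans_eq log_y_eq)
    exact sum_le_sum_of_subset_of_nonneg subset_a fun q _ _ =>
      mul_nonneg (hw0 q) (Real.log_natCast_nonneg q)
  have mass_b_le : divisorMass (logWeight l) b ≤ Real.exp (2 * K ^ 2) := by
    refine (divisorMass_le_exp hw hw0 b).trans (Real.exp_le_exp.2 ?_)
    have ratio_eq : K * L / Real.log y = 2 * K ^ 2 := by
      rw [hy, Real.log_exp]
      field_simp
    refine le_trans ?_ ((h.sum_of_lt_minFac_le hl hA.le hB.le one_lt_y).trans_eq ratio_eq)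
    exact sum_le_sum_of_subset_of_nonneg subset_b fun q _ _ => hw0 q
  rw [← hD, divisorMass_mul_of_coprime hw hab, mul_right_comm]
  exact mul_le_mul mass_a_le mass_b_le (divisorMass_nonneg hw0 b)
    (mul_nonneg zero_le_two (sum_nonneg fun n _ => hw0 n))

theorem biasFactor_lcmUpto_le :
    biasFactor (logWeight l) ⌊x⌋₊.lcmUpto ≤ 2 * A ^ 2 + 2 * B := by
  have prime_part_le :
      ∑ p ∈ primePowersUpTo x with p.Prime, logWeight l p ^ 2 ≤ A ^ 2 * 2 :=
    calc _ ≤ ∑ p ∈ primePowersUpTo x with p.Prime, A ^ 2 * ((p : ℝ) ^ 2)⁻¹ :=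
          sum_le_sum fun p hp => by
          rw [mem_filter] at hp
          rw [← div_eq_mul_inv, ← div_pow]
          exact pow_le_pow_left₀ (logWeight_nonneg hl p) (h.logWeight_prime_le hl hp.2 hp.1) 2
      _ ≤ ∑ n ∈ Ioo 0 (⌊x⌋₊ + 1), A ^ 2 * ((n : ℝ) ^ 2)⁻¹ := by
          refine sum_le_sum_of_subset_of_nonneg (fun p hp => ?_) fun n _ _ => by positivity
          have p_mem := mem_Icc.1 (mem_filter.1 (mem_filter.1 hp).1).1
          exact mem_Ioo.2 ⟨p_mem.1, Nat.lt_succ_of_le p_mem.2⟩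
      _ ≤ A ^ 2 * 2 := by
          rw [← mul_sum]
          gcongr
          simpa using sum_Ioo_inv_sq_le (α := ℝ) 0 (⌊x⌋₊ + 1)
  have proper_part_le : ∑ q ∈ properPrimePowersUpTo x, logWeight l q ≤ 2 * B :=
    calc _ ≤ ∑ q ∈ properPrimePowersUpTo x, 2 * (logWeight l q * Real.log q) :=
          sum_le_sum fun q hq => by
          have half_le_log := half_le_log_of_mem_primePowersUpTo (mem_filter.1 hq).1
          linarith [mul_le_mul_of_nonneg_left half_le_log (logWeight_nonneg hl q)]
      _ ≤ 2 * B := by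
          rw [← mul_sum]
          exact mul_le_mul_of_nonneg_left (h.sum_properPrimePowers_le hl) zero_le_two
  rw [biasFactor, primePowerDivisors_lcmUpto_floor, sum_ite, mul_comm 2 (A ^ 2)]
  exact add_le_add prime_part_le proper_part_le

end MemMultClass

end MultiplicativeClass

theorem mainTheorem11_general {E : Type*} [NormedAddCommGroup E] [InnerProductSpace ℝ E] (A B : ℝ)
    (hA : 0 < A) (hB : 0 < B) :
    ∃ C : ℝ, ∀ (x : ℝ) (l : ArithmeticFunction ℝ) (θ : ℕ → E), 1 ≤ x →
      MemMultClass x A B l → (∀ n : ℕ, 0 ≤ l n) → IsCoprimeAdditive θ →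
      ∑ n ∈ Finset.Icc 1 ⌊x⌋₊,
          l n / (n : ℝ) * ‖θ n - ∑ q ∈ primePowersUpTo x, (l q / (q : ℝ)) • θ q‖ ^ 2 ≤
        C * ((∑ n ∈ Finset.Icc 1 ⌊x⌋₊, l n / (n : ℝ)) *
          ∑ q ∈ primePowersUpTo x, l q / (q : ℝ) * ‖θ q‖ ^ 2) := by
  refine ⟨2 * Real.exp (2 * (3 * A + 2 * B) ^ 2) * (1 + (2 * A ^ 2 + 2 * B)),
    fun x l θ hx h hl hθ => ?_⟩
  have hw0 := logWeight_nonneg hl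
  have mean_eq : ∑ q ∈ primePowersUpTo x, (l q / (q : ℝ)) • θ q =
      approxMean (logWeight l) θ ⌊x⌋₊.lcmUpto := by
    rw [approxMean, primePowerDivisors_lcmUpto_floor]
    rfl
  have variance_eq : ∑ q ∈ primePowersUpTo x, l q / (q : ℝ) * ‖θ q‖ ^ 2 =
      approxVariance (logWeight l) θ ⌊x⌋₊.lcmUpto := by
    rw [approxVariance, primePowerDivisors_lcmUpto_floor]
    rfl
  have Icc_subset : Finset.Icc 1 ⌊x⌋₊ ⊆ ⌊x⌋₊.lcmUpto.divisors := fun n hn =>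
    Nat.mem_divisors.2 ⟨dvd_lcmUpto_of_le (by grind) (by grind), ⌊x⌋₊.lcmUpto_ne_zero⟩
  rw [mean_eq, variance_eq]
  set S := ∑ n ∈ Finset.Icc 1 ⌊x⌋₊, l n / (n : ℝ)
  calc _ ≤ ∑ d ∈ ⌊x⌋₊.lcmUpto.divisors,
          logWeight l d * ‖θ d - approxMean (logWeight l) θ ⌊x⌋₊.lcmUpto‖ ^ 2 :=
        Finset.sum_le_sum_of_subset_of_nonneg Icc_subset fun d _ _ =>
          mul_nonneg (hw0 d) (sq_nonneg _)
    _ ≤ divisorMass (logWeight l) ⌊x⌋₊.lcmUpto * ((1 + biasFactor (logWeight l) ⌊x⌋₊.lcmUpto) *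
          approxVariance (logWeight l) θ ⌊x⌋₊.lcmUpto) :=
        sum_divisors_mul_norm_sub_approxMean_sq_le
          (isMultiplicative_logWeight h.isMultiplicative) hw0 hθ _
    _ ≤ 2 * Real.exp (2 * (3 * A + 2 * B) ^ 2) * S * ((1 + (2 * A ^ 2 + 2 * B)) *
          approxVariance (logWeight l) θ ⌊x⌋₊.lcmUpto) := by
        have variance_nonneg := approxVariance_nonneg hw0 θ ⌊x⌋₊.lcmUpto
        have bias_nonneg := biasFactor_nonneg hw0 ⌊x⌋₊.lcmUpto
        have S_nonneg : 0 ≤ S := Finset.sum_nonneg fun n _ => hw0 n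
        gcongr
        · exact h.divisorMass_lcmUpto_le hl hx hA hB
        · exact h.biasFactor_lcmUpto_le hl
    _ = _ := by ring

theorem mainTheorem11 (A B : ℝ) (hA : 0 < A) (hB : 0 < B) :
    ∃ C : ℝ, ∀ (x : ℝ) (l : ArithmeticFunction ℝ) (θ : ℕ → ℂ), 1 ≤ x →
      MemMultClass x A B l → (∀ n : ℕ, 0 ≤ l n) → IsAdditiveArith θ →
      ∑ n ∈ Finset.Icc 1 ⌊x⌋₊, l n / (n : ℝ) * ‖θ n - firstMoment l θ x‖ ^ 2 ≤
        C * ((∑ n ∈ Finset.Icc 1 ⌊x⌋₊, l n / (n : ℝ)) * secondMoment l θ x) := by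
  obtain ⟨C, hC⟩ := mainTheorem11_general (E := ℂ) A B hA hB
  refine ⟨C, fun x l θ hx h hl hθ => ?_⟩
  simpa only [firstMoment, secondMoment, mul_div_right_comm, Complex.real_smul,
    Complex.ofReal_div, Complex.ofReal_natCast] using hC x l θ hx h hl hθ
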